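/- Let $p\ge 1$ be an integer, let $\mathcal X=[0,1]^p$, and let $d$ be the Euclidean distance on $\mathcal X$. For $s\in(0,\infty)$ put $d_s(u,v)=\bigl(\frac1p\sum_{l=1}^p|u_l-v_l|^s\bigr)^{1/s}$. Given a charge function $q:\mathcal X\to(0,\infty)$ and $n\ge 1$, an $n$-point minimum energy design (for $d_s$) is a design $D=\{x_1,\dots,x_n\}\subset\mathcal X$ that maximizes $$\psi(D)=\min_{i\ne j}\frac{d_s(x_i,x_j)}{q(x_i)\,q(x_j)}$$ over all $n$-point designs in $\mathcal X$ (for $n=1$ there is no pair and every design is optimal). The index of a design is the number of unordered pairs of its points that attain the minimum in $\psi(D)$; a minimum energy design has the smallest index if no other $n$-point minimum energy design has a smaller one. (1) Suppose that $q>0$ is Lipschitz continuous, i.e. there is $L>0$ with $|q(u)-q(v)|\le L\,d(u,v)$ for all $u,v\in\mathcal X$. Then there is a Borel probability measure $\mathcal P$ on $\mathcal X$, not depending on $s$, such that for every fixed $s\in(0,\infty)$ and every choice, for each $n\ge1$, of an $n$-point minimum energy design $D_n^*=\{x_1^*,\dots,x_n^*\}$ for $d_s$ with the smallest index, the empirical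 measures $\mathcal P_n(A)=\frac1n\,\mathrm{card}\{i: x_i^*\in A\}$ converge weakly to $\mathcal P$ as $n\to\infty$. Moreover, $\mathcal P$ has a density with respect to Lebesgue measure on $\mathcal X$ proportional to $1/q^{2p}$, namely $q^{-2p}/\int_{\mathcal X}q^{-2p}$. (2) In particular, let $f:\mathcal X\to(0,\infty)$ be a (possibly unnormalized) target density such that $q=f^{-1/(2p)}$ is Lipschitz continuous. Then for every $s\in(0,\infty)$ the empirical measures of the $n$-point minimum energy designs with the smallest index for the criterion $\min_{i\ne j} f^{1/(2p)}(x_i)f^{1/(2p)}(x_j)d_s(x_i,x_j)$ converge weakly, as $n\to\infty$, to the probability measure with density $f/\int_{\mathcal X}f$ on $\mathcal X$, which does not depend on $s$. -/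

import Mathlib

open MeasureTheory Filter Topology

/-- The unit cube `[0,1]^p`. It carries the product topology, its Borel σ-algebra, and
Lebesgue measure `volume` (the product of Lebesgue measure on `[0,1]`). -/
abbrev Cube (p : ℕ) : Type := Fin p → unitInterval

/-- The Euclidean distance on the unit cube. -/
noncomputable def euclidDist {p : ℕ} (u v : Cube p) : ℝ :=
  Real.sqrt (∑ l, ((u l : ℝ) - (v l : ℝ)) ^ 2)

/-- Lipschitz continuity on the unit cube with respect to the Euclidean distance. -/
def LipschitzOnCube {p : ℕ} (q : Cube p → ℝ) : Prop :=
  ∃ L : ℝ, 0 < L ∧ ∀ u v : Cube p, |q u - q v| ≤ L * euclidDist u v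

/-- The generalized distance `d_s(u,v) = ((1/p) ∑ |u_l - v_l|^s)^(1/s)`. -/
noncomputable def genDist {p : ℕ} (s : ℝ) (u v : Cube p) : ℝ :=
  ((1 / (p : ℝ)) * ∑ l, |(u l : ℝ) - (v l : ℝ)| ^ s) ^ (1 / s)

/-- The term `w(x_i) w(x_j) d_s(x_i, x_j)` that a pair of design points contributes to the
criterion; `w` is the reciprocal of the charge function. -/
noncomputable def pairValue {p n : ℕ} (s : ℝ) (w : Cube p → ℝ) (D : Fin n → Cube p)
    (i j : Fin n) : ℝ :=
  w (D i) * w (D j) * genDist s (D i) (D j)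

/-- The criterion `ψ(D) = min_{i ≠ j} w(x_i) w(x_j) d_s(x_i, x_j)`. The infimum is over a finite
set, hence a minimum as soon as `n ≥ 2`; for `n ≤ 1` there are no pairs and `ψ` is constant. -/
noncomputable def medCriterion {p n : ℕ} (s : ℝ) (w : Cube p → ℝ) (D : Fin n → Cube p) : ℝ :=
  ⨅ e : {e : Fin n × Fin n // e.1 ≠ e.2}, pairValue s w D e.1.1 e.1.2

/-- `D` is an `n`-point minimum energy design: it maximizes the criterion over all `n`-point
designs in the unit cube. -/
def IsMED {p n : ℕ} (s : ℝ) (w : Cube p → ℝ) (D : Fin n → Cube p) : Prop :=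
  ∀ D' : Fin n → Cube p, medCriterion s w D' ≤ medCriterion s w D

/-- The index of a design: the number of (unordered) pairs of design points that attain the
minimum in the criterion. -/
noncomputable def medIndex {p n : ℕ} (s : ℝ) (w : Cube p → ℝ) (D : Fin n → Cube p) : ℕ :=
  Set.ncard {e : Fin n × Fin n | e.1 < e.2 ∧ pairValue s w D e.1 e.2 = medCriterion s w D}

/-- `D` is an `n`-point minimum energy design with the smallest index among all `n`-point
minimum energy designs. -/
def IsSmallestIndexMED {p n : ℕ} (s : ℝ) (w : Cube p → ℝ) (D : Fin n → Cube p) : Prop :=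
  IsMED s w D ∧ ∀ D' : Fin n → Cube p, IsMED s w D' → medIndex s w D ≤ medIndex s w D'

/-- The empirical measure of an `n`-point design, `n ≥ 1`: mass `1/n` at each design point. -/
noncomputable def empiricalMeasure {p : ℕ} {n : ℕ+} (D : Fin n → Cube p) :
    ProbabilityMeasure (Cube p) :=
  ⟨((n : ℕ) : ENNReal)⁻¹ • ∑ i, Measure.dirac (D i), ⟨by
    simp [ENNReal.inv_mul_cancel]⟩⟩

/-- `P` has density `g / ∫ g` with respect to Lebesgue measure on the unit cube. -/
def HasNormalizedDensity {p : ℕ} (P : ProbabilityMeasure (Cube p)) (g : Cube p → ℝ) : Prop :=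
  (P : Measure (Cube p)) = volume.withDensity (fun x => ENNReal.ofReal (g x / ∫ y, g y))

/-! Write `w = 1/q`. The maximal number of points in a box of side `a` at mutual `d_s`-distance at
least `1` is asymptotic to `Δ a^p` for some `Δ > 0` (`exists_packing_density`). In a small cell `w`
is almost constant, so a design whose pair values are all at least `r` is there a packing at
distance about `r / w²` and has at most about `Δ w^(2p) r^(-p)` points per unit volume. Summing over
cells bounds `r^p ∑ φ(x_i)` by about `Δ ∫ φ w^(2p)` for every `φ ≥ 0` (`eventually_pow_mul_sum_lt`).
Conversely, optimal packings of slightly shrunk cells combine into designs with about `Δ r^(-p) ∫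
w^(2p)` points (`eventually_exists_design`).

An optimal design does at least as well as the constructed one, so dividing the two estimates bounds
the mean of `φ` asymptotically by `∫ φ w^(2p) / ∫ w^(2p)`; using `-φ` as well gives equality in the
limit. Only `Δ` depends on `s`, and it cancels. For `s < 1` the triangle inequality may fail;
homogeneity and comparison with the sup norm suffice. -/

/-- The distance `d_s` on `ℝ^p`. -/
noncomputable def powerDist {p : ℕ} (s : ℝ) (u v : Fin p → ℝ) : ℝ :=
  ((1 / (p : ℝ)) * ∑ l, |u l - v l| ^ s) ^ (1 / s)

theorem powerDist_nonneg {p : ℕ} (s : ℝ) (u v : Fin p → ℝ) : 0 ≤ powerDist s u v := by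
  unfold powerDist; positivity

theorem powerDist_of_abs_eq {p : ℕ} {s a : ℝ} (hs : 0 < s) (ha : 0 ≤ a) {u v u' v' : Fin p → ℝ}
    (h : ∀ l, |u' l - v' l| = a * |u l - v l|) : powerDist s u' v' = a * powerDist s u v := by
  unfold powerDist
  have : (1 / (p : ℝ)) * ∑ l, |u' l - v' l| ^ s =
      a ^ s * ((1 / (p : ℝ)) * ∑ l, |u l - v l| ^ s) := by
    simp_rw [h, Real.mul_rpow ha (abs_nonneg _), ← Finset.mul_sum]
    ring
  rw [this, Real.mul_rpow (by positivity) (by positivity), ← Real.rpow_mul ha,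
    mul_one_div_cancel hs.ne', Real.rpow_one]

theorem powerDist_le {p : ℕ} (hp : 1 ≤ p) {s h : ℝ} (hs : 0 < s) (hh : 0 ≤ h) {u v : Fin p → ℝ}
    (huv : ∀ l, |u l - v l| ≤ h) : powerDist s u v ≤ h := by
  have hp' : (0 : ℝ) < p := by exact_mod_cast hp
  have h1 : (1 / (p : ℝ)) * ∑ l, |u l - v l| ^ s ≤ h ^ s := by
    rw [one_div, inv_mul_le_iff₀ hp']
    calc ∑ l, |u l - v l| ^ s ≤ ∑ _l : Fin p, h ^ s :=
          Finset.sum_le_sum fun l _ => Real.rpow_le_rpow (abs_nonneg _) (huv l) hs.le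
      _ = p * h ^ s := by simp
  calc powerDist s u v ≤ (h ^ s) ^ (1 / s) :=
        Real.rpow_le_rpow (by positivity) h1 (by positivity)
    _ = h := by rw [← Real.rpow_mul hh, mul_one_div_cancel hs.ne', Real.rpow_one]

theorem abs_sub_le_powerDist {p : ℕ} {s : ℝ} (hs : 0 < s) (u v : Fin p → ℝ) (l : Fin p) :
    |u l - v l| ≤ (p : ℝ) ^ (1 / s) * powerDist s u v := by
  have hp' : (0 : ℝ) < p := by exact_mod_cast l.pos
  have h1 : |u l - v l| ^ s ≤ ∑ l, |u l - v l| ^ s :=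
    Finset.single_le_sum (f := fun l => |u l - v l| ^ s) (fun _ _ => by positivity)
      (Finset.mem_univ l)
  unfold powerDist
  rw [← Real.mul_rpow hp'.le (by positivity), ← mul_assoc, mul_one_div_cancel hp'.ne', one_mul]
  calc |u l - v l| = (|u l - v l| ^ s) ^ (1 / s) := by
        rw [← Real.rpow_mul (abs_nonneg _), mul_one_div_cancel hs.ne', Real.rpow_one]
    _ ≤ _ := Real.rpow_le_rpow (by positivity) h1 (by positivity)

/-! ### Packings of boxes and their asymptotic density. -/

/-- A box of side `a` is covered by `k ^ p` closed boxes of side `a / k`. -/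
theorem exists_cell {p k : ℕ} (hk : 0 < k) {a : ℝ} {x : Fin p → ℝ}
    (hx : ∀ l, 0 ≤ x l ∧ x l ≤ a) :
    ∃ c : Fin p → Fin k, ∀ l, (c l : ℝ) * (a / k) ≤ x l ∧ x l ≤ (c l : ℝ) * (a / k) + a / k := by
  have hk' : (0 : ℝ) < k := by exact_mod_cast hk
  suffices ∀ l, ∃ j : Fin k, (j : ℝ) * (a / k) ≤ x l ∧ x l ≤ (j : ℝ) * (a / k) + a / k by
    choose c hc using this
    exact ⟨c, hc⟩
  intro l
  obtain ⟨h0, h1⟩ := hx l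
  rcases h1.eq_or_lt with h1 | h1
  -- At the right end point the floor used below could give the index `k`, so the last cell is
  -- taken.
  · refine ⟨⟨k - 1, by omega⟩, ?_, le_of_eq ?_⟩
    · simp only [Nat.cast_sub (show 1 ≤ k from hk), Nat.cast_one]
      have : 0 ≤ a / k := div_nonneg (h1 ▸ h0) hk'.le
      rw [h1]
      calc ((k : ℝ) - 1) * (a / k) = a - a / k := by field_simp
        _ ≤ a := by linarith
    · simp only [Nat.cast_sub (show 1 ≤ k from hk), Nat.cast_one]
      rw [h1]; field_simp; ring
  · have ha : 0 < a := h0.trans_lt h1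
    have hak : 0 < a / k := by positivity
    have hf : ⌊x l / (a / k)⌋₊ < k := by
      rw [Nat.floor_lt (by positivity), div_lt_iff₀ hak]
      calc x l < a := h1
        _ = k * (a / k) := by field_simp
    refine ⟨⟨_, hf⟩, ?_, ?_⟩
    · simpa [le_div_iff₀ hak] using Nat.floor_le (show 0 ≤ x l / (a / k) by positivity)
    · have := (Nat.lt_floor_add_one (x l / (a / k))).le
      rw [div_le_iff₀ hak] at this
      simpa [add_mul] using this

/-- Pairwise `d_s`-distances in the family `x` are at least `t`. -/
def IsSeparated {p : ℕ} {ι : Type*} (s t : ℝ) (x : ι → Fin p → ℝ) : Prop :=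
  Pairwise fun i j => t ≤ powerDist s (x i) (x j)

/-- All points of `x` lie in the box with lower corner `b` and side `h`. -/
def InBox {p : ℕ} {ι : Type*} (b : Fin p → ℝ) (h : ℝ) (x : ι → Fin p → ℝ) : Prop :=
  ∀ i l, b l ≤ x i l ∧ x i l ≤ b l + h

/-- The largest number of points in `[0,a]^p` with pairwise `d_s`-distances at least `1`. -/
noncomputable def packingNumber (p : ℕ) (s a : ℝ) : ℕ :=
  sSup {m | ∃ x : Fin m → Fin p → ℝ, InBox 0 a x ∧ IsSeparated s 1 x}

theorem card_le_of_inBox {p k B : ℕ} (hk : 0 < k) {ι : Type*} [Fintype ι] {x : ι → Fin p → ℝ}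
    {a : ℝ} (hx : InBox 0 a x)
    (h : ∀ (b : Fin p → ℝ) (S : Finset ι), InBox b (a / k) (fun i : S => x i) → S.card ≤ B) :
    Fintype.card ι ≤ k ^ p * B := by
  classical
  have hc : ∀ i, ∃ c : Fin p → Fin k, ∀ l, (c l : ℝ) * (a / k) ≤ x i l ∧
      x i l ≤ (c l : ℝ) * (a / k) + a / k :=
    fun i => exists_cell hk fun l => by simpa using hx i l
  choose c hc using hc
  have h1 := Finset.card_le_mul_card_image_of_maps_to (f := c) (s := (Finset.univ : Finset ι))
    (t := Finset.univ) (fun _ _ => Finset.mem_univ _) B ?_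
  · simpa [mul_comm] using h1
  · intro d _
    refine h (fun l => (d l : ℝ) * (a / k)) _ ?_
    rintro ⟨i, hi⟩ l
    have hi' : c i = d := by simpa using hi
    simpa [hi'] using hc i l

theorem nonempty_packing (p : ℕ) (s a : ℝ) :
    {m | ∃ x : Fin m → Fin p → ℝ, InBox 0 a x ∧ IsSeparated s 1 x}.Nonempty :=
  ⟨0, fun i => i.elim0, fun i => i.elim0, fun i => i.elim0⟩

/-- Sub-boxes of side `a / (⌊a⌋₊ + 1) < 1` hold at most one point each. This makes the `sSup` in
`packingNumber` an attained maximum. -/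
theorem bddAbove_packing {p : ℕ} (hp : 1 ≤ p) {s : ℝ} (hs : 0 < s) (a : ℝ) :
    BddAbove {m | ∃ x : Fin m → Fin p → ℝ, InBox 0 a x ∧ IsSeparated s 1 x} := by
  refine ⟨(⌊a⌋₊ + 1) ^ p * 1, ?_⟩
  rintro m ⟨x, hx, hsep⟩
  rw [← Fintype.card_fin m]
  refine card_le_of_inBox (Nat.succ_pos _) hx fun b S hS => ?_
  by_contra! hS1
  obtain ⟨i, hi, j, hj, hij⟩ := Finset.one_lt_card.mp hS1
  have h1 : 1 ≤ powerDist s (x i) (x j) := hsep hij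
  have ha : a / (⌊a⌋₊ + 1 : ℕ) < 1 := by
    rw [div_lt_one (by positivity)]
    exact_mod_cast Nat.lt_floor_add_one a
  have hbi := hS ⟨i, hi⟩
  have hbj := hS ⟨j, hj⟩
  have h0 : 0 ≤ a / (⌊a⌋₊ + 1 : ℕ) := by
    have := hbi ⟨0, hp⟩
    linarith
  have := powerDist_le hp hs h0 (u := x i) (v := x j) fun l => by
    have h2 := hbi l
    have h3 := hbj l
    rw [abs_le]; constructor <;> simp only at h2 h3 <;> linarith
  linarith

theorem card_le_packingNumber {p : ℕ} (hp : 1 ≤ p) {s : ℝ} (hs : 0 < s) {ι : Type*} [Fintype ι]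
    {x : ι → Fin p → ℝ} {b : Fin p → ℝ} {h t : ℝ} (ht : 0 < t) (hx : InBox b h x)
    (hsep : IsSeparated s t x) : Fintype.card ι ≤ packingNumber p s (h / t) := by
  refine le_csSup (bddAbove_packing hp hs _) ?_
  let e := (Fintype.equivFin ι).symm
  refine ⟨fun i l => (x (e i) l - b l) / t, ?_, ?_⟩
  · intro i l
    have := hx (e i) l
    constructor
    · exact div_nonneg (by linarith) ht.le
    · simp only [Pi.zero_apply, zero_add]
      gcongr; linarith
  · intro i j hij
    have h1 : t ≤ powerDist s (x (e i)) (x (e j)) := hsep (e.injective.ne hij)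
    simp only
    rw [powerDist_of_abs_eq hs (inv_nonneg.mpr ht.le) (u := x (e i)) (v := x (e j))]
    · rwa [← div_eq_inv_mul, one_le_div ht]
    · intro l
      rw [← sub_div, abs_div, abs_of_pos ht, sub_sub_sub_cancel_right, div_eq_inv_mul]

theorem exists_packing {p : ℕ} (hp : 1 ≤ p) {s : ℝ} (hs : 0 < s) (b : Fin p → ℝ) {h t : ℝ}
    (ht : 0 < t) : ∃ x : Fin (packingNumber p s (h / t)) → Fin p → ℝ,
      InBox b h x ∧ IsSeparated s t x := by
  obtain ⟨x, hx, hsep⟩ := Nat.sSup_mem (nonempty_packing p s (h / t))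
    (bddAbove_packing hp hs (h / t))
  refine ⟨fun i l => b l + t * x i l, ?_, ?_⟩
  · intro i l
    have := hx i l
    simp only [Pi.zero_apply, zero_add, le_div_iff₀ ht] at this
    constructor
    · nlinarith [this.1]
    · linarith [this.2, mul_comm t (x i l)]
  · intro i j hij
    have h1 : 1 ≤ powerDist s (x i) (x j) := hsep hij
    simp only
    rw [powerDist_of_abs_eq hs ht.le (u := x i) (v := x j)]
    · nlinarith
    · intro l
      rw [add_sub_add_left_eq_sub, ← mul_sub, abs_mul, abs_of_pos ht]

theorem packingNumber_mono {p : ℕ} (hp : 1 ≤ p) {s : ℝ} (hs : 0 < s) :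
    Monotone (packingNumber p s) := by
  intro a b hab
  refine csSup_le_csSup (bddAbove_packing hp hs b)
    (nonempty_packing p s a) ?_
  rintro m ⟨x, hx, hsep⟩
  exact ⟨x, fun i l => ⟨(hx i l).1, (hx i l).2.trans (by gcongr)⟩, hsep⟩

theorem packingNumber_mul_le {p : ℕ} (hp : 1 ≤ p) {s : ℝ} (hs : 0 < s) {k : ℕ} (hk : 0 < k)
    (a : ℝ) : packingNumber p s (k * a) ≤ k ^ p * packingNumber p s a := by
  have hk' : (k : ℝ) ≠ 0 := by exact_mod_cast hk.ne'
  obtain ⟨x, hx, hsep⟩ := exists_packing hp hs (s := s) 0 (h := k * a) one_pos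
  have h := card_le_of_inBox (B := packingNumber p s a) hk hx fun b S hS => by
    rw [mul_div_cancel_left₀ _ hk'] at hS
    simpa using card_le_packingNumber hp hs one_pos hS
      (hsep.comp_of_injective Subtype.val_injective)
  simpa using h

/-- The lattice of spacing `p^(1/s)` is `1`-separated: one coordinate differing by that much already
forces `d_s ≥ 1`. This is what makes the density `Δ` positive. -/
theorem le_packingNumber {p : ℕ} (hp : 1 ≤ p) {s a : ℝ} (hs : 0 < s) (ha : 0 ≤ a) :
    (a / (p : ℝ) ^ (1 / s)) ^ p ≤ packingNumber p s a := by
  have hp' : (0 : ℝ) < p := by exact_mod_cast hp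
  set c := (p : ℝ) ^ (1 / s) with hc_def
  have hc : 0 < c := by positivity
  set k := ⌊a / c⌋₊ + 1 with hk
  have hka : (k - 1 : ℝ) * c ≤ a := by
    rw [hk]; push_cast
    have := Nat.floor_le (show 0 ≤ a / c by positivity)
    rw [le_div_iff₀ hc] at this
    simpa using this
  have h1 := card_le_packingNumber hp hs (ι := Fin p → Fin k) (x := fun d l => (d l : ℝ) * c)
    (b := 0) (h := a) one_pos ?_ ?_
  · simp only [Fintype.card_fun, Fintype.card_fin, div_one] at h1
    calc (a / c) ^ p ≤ (k : ℝ) ^ p := by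
          gcongr
          rw [hk]; push_cast
          exact (Nat.lt_floor_add_one _).le
      _ ≤ _ := by exact_mod_cast h1
  · intro d l
    refine ⟨by positivity, ?_⟩
    simp only [Pi.zero_apply, zero_add]
    refine le_trans ?_ hka
    gcongr
    have : ((d l : ℕ) : ℝ) + 1 ≤ k := by exact_mod_cast (d l).2
    linarith
  · intro d e hde
    obtain ⟨l, hl⟩ := Function.ne_iff.mp hde
    have h2 := abs_sub_le_powerDist hs (fun l => (d l : ℝ) * c) (fun l => (e l : ℝ) * c) l
    have h3 : (1 : ℝ) ≤ |(d l : ℝ) - e l| := by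
      have h4 : ((d l : ℕ) : ℤ) - ((e l : ℕ) : ℤ) ≠ 0 := by
        intro h; apply hl; ext; omega
      exact_mod_cast Int.one_le_abs h4
    rw [← hc_def, ← sub_mul, abs_mul, abs_of_pos hc] at h2
    have h5 : c * 1 ≤ c * powerDist s (fun l => (d l : ℝ) * c) (fun l => (e l : ℝ) * c) := by
      nlinarith
    exact le_of_mul_le_mul_left h5 hc

/-- The packing number of a box is asymptotically proportional to its volume. -/
theorem exists_packing_density {p : ℕ} (hp : 1 ≤ p) {s : ℝ} (hs : 0 < s) :
    ∃ Δ : ℝ, 0 < Δ ∧ Tendsto (fun a : ℝ => packingNumber p s a / a ^ p) atTop (𝓝 Δ) := by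
  have hp' : (0 : ℝ) < p := by exact_mod_cast hp
  set c := (p : ℝ) ^ (1 / s) with hc_def
  have hc : 0 < c := by positivity
  let θ : Set.Ioi (0 : ℝ) → ℝ := fun a => packingNumber p s a / (a : ℝ) ^ p
  have : Nonempty (Set.Ioi (0 : ℝ)) := ⟨⟨1, Set.mem_Ioi.mpr one_pos⟩⟩
  have hlow : ∀ a, (1 / c) ^ p ≤ θ a := by
    rintro ⟨a, ha⟩
    have ha' : 0 < a := ha
    have := le_packingNumber hp hs ha'.le
    rw [← hc_def] at this
    simp only [θ]
    rw [le_div_iff₀ (by positivity), ← mul_pow, one_div_mul_eq_div]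
    exact this
  have hbdd : BddBelow (Set.range θ) := ⟨_, by rintro _ ⟨a, rfl⟩; exact hlow a⟩
  -- As in Fekete's lemma, the limit is the infimum. For the upper half, a box of side `b` with `θ
  -- b` nearly minimal tiles a cover of the large box, `⌈a / b⌉₊` copies per axis.
  refine ⟨⨅ a, θ a, lt_of_lt_of_le (by positivity) (le_ciInf hlow), ?_⟩
  refine tendsto_order.mpr ⟨fun y hy => ?_, fun y hy => ?_⟩
  · filter_upwards [eventually_gt_atTop 0] with a ha
    exact hy.trans_le (ciInf_le hbdd ⟨a, ha⟩)
  · obtain ⟨⟨b, hb⟩, hby⟩ := exists_lt_of_ciInf_lt hy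
    have hb' : 0 < b := hb
    have hlim : Tendsto (fun a : ℝ => (1 / b + 1 / a) ^ p * packingNumber p s b) atTop
        (𝓝 ((1 / b + 0) ^ p * packingNumber p s b)) := by
      refine ((tendsto_const_nhds.add ?_).pow p).mul tendsto_const_nhds
      exact tendsto_const_nhds.div_atTop tendsto_id
    have hby' : (1 / b + 0) ^ p * packingNumber p s b < y := by
      rw [add_zero, one_div_pow, one_div_mul_eq_div]
      exact hby
    filter_upwards [hlim.eventually_lt_const hby', eventually_gt_atTop 0] with a ha ha0
    refine lt_of_le_of_lt ?_ ha
    have hk : 0 < ⌈a / b⌉₊ := Nat.ceil_pos.mpr (by positivity)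
    have h1 : packingNumber p s a ≤ ⌈a / b⌉₊ ^ p * packingNumber p s b :=
      (packingNumber_mono hp hs (by rw [← div_le_iff₀ hb']; exact Nat.le_ceil _)).trans
        (packingNumber_mul_le hp hs hk b)
    have h2 : (packingNumber p s a : ℝ) ≤ (⌈a / b⌉₊ : ℝ) ^ p * packingNumber p s b := by
      exact_mod_cast h1
    have h3 : (⌈a / b⌉₊ : ℝ) ≤ (1 / b + 1 / a) * a := by
      calc (⌈a / b⌉₊ : ℝ) ≤ a / b + 1 := (Nat.ceil_lt_add_one (by positivity)).le
        _ = _ := by field_simp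
    rw [div_le_iff₀ (by positivity)]
    calc (packingNumber p s a : ℝ) ≤ (⌈a / b⌉₊ : ℝ) ^ p * packingNumber p s b := h2
      _ ≤ ((1 / b + 1 / a) * a) ^ p * packingNumber p s b := by gcongr
      _ = _ := by rw [mul_pow]; ring

/-- The side `β` may vary with `r` because the shrunk cells of the construction do. -/
theorem tendsto_pow_mul_packingNumber {p : ℕ} {s Δ : ℝ}
    (hΔ : Tendsto (fun a : ℝ => packingNumber p s a / a ^ p) atTop (𝓝 Δ)) {β : ℝ → ℝ} {β₀ : ℝ}
    (hβ₀ : 0 < β₀) (hβ : Tendsto β (𝓝[>] 0) (𝓝 β₀)) :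
    Tendsto (fun r => r ^ p * packingNumber p s (β r / r)) (𝓝[>] 0) (𝓝 (Δ * β₀ ^ p)) := by
  have h1 : Tendsto (fun r => β r / r) (𝓝[>] 0) atTop := by
    simp_rw [div_eq_mul_inv]
    exact hβ.pos_mul_atTop hβ₀ tendsto_inv_nhdsGT_zero
  refine ((hΔ.comp h1).mul (hβ.pow p)).congr' ?_
  filter_upwards [self_mem_nhdsWithin, hβ.eventually_const_lt hβ₀] with r hr hβr
  have hr' : 0 < r := hr
  simp only [Function.comp, div_pow]
  field_simp

/-! ### Grid cells and Riemann sums on the cube. -/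

/-- The index of the interval `[j/k, (j+1)/k)` containing a point of `[0,1]`, where the last
interval is closed. -/
noncomputable def gridIndex {k : ℕ} (hk : 0 < k) (x : unitInterval) : Fin k :=
  ⟨min ⌊(k : ℝ) * x⌋₊ (k - 1), by omega⟩

theorem measurable_gridIndex {k : ℕ} (hk : 0 < k) : Measurable (gridIndex hk) := by
  have h : Measurable fun x : unitInterval => min ⌊(k : ℝ) * x⌋₊ (k - 1) :=
    (Nat.measurable_floor.comp (measurable_subtype_coe.const_mul _)).min measurable_const
  refine measurable_to_countable' fun j => ?_
  have : gridIndex hk ⁻¹' {j} = (fun x : unitInterval => min ⌊(k : ℝ) * x⌋₊ (k - 1)) ⁻¹' {j.1} := by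
    ext x; simp [gridIndex, Fin.ext_iff]
  rw [this]
  exact h (measurableSet_singleton _)

/-- The lower end point of an interval of the grid. -/
noncomputable def gridPoint {k : ℕ} (j : Fin k) : unitInterval :=
  ⟨(j : ℝ) / k, by positivity, div_le_one_of_le₀ (by exact_mod_cast j.2.le) (by positivity)⟩

/-- The upper end point of an interval of the grid. -/
noncomputable def gridPointSucc {k : ℕ} (j : Fin k) : unitInterval :=
  ⟨((j : ℝ) + 1) / k, by positivity,
    div_le_one_of_le₀ (by exact_mod_cast j.2) (by positivity)⟩

theorem mem_Icc_gridIndex {k : ℕ} (hk : 0 < k) (x : unitInterval) :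
    x ∈ Set.Icc (gridPoint (gridIndex hk x)) (gridPointSucc (gridIndex hk x)) := by
  have hk' : (0 : ℝ) < k := by exact_mod_cast hk
  have h0 := x.2.1
  have h1 : (x : ℝ) ≤ 1 := x.2.2
  constructor
  · rw [← Subtype.coe_le_coe]
    simp only [gridPoint, gridIndex]
    rw [div_le_iff₀' hk']
    exact (Nat.cast_le.mpr (min_le_left _ _)).trans (Nat.floor_le (by positivity))
  · rw [← Subtype.coe_le_coe]
    simp only [gridPointSucc, gridIndex]
    rw [le_div_iff₀' hk']
    rcases le_total ⌊(k : ℝ) * x⌋₊ (k - 1) with h | h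
    · rw [min_eq_left h]; exact (Nat.lt_floor_add_one _).le
    · rw [min_eq_right h, Nat.cast_sub (show 1 ≤ k from hk)]
      push_cast; nlinarith

theorem gridIndex_eq_of_mem_Ico {k : ℕ} (hk : 0 < k) {j : Fin k} {x : unitInterval}
    (hx : x ∈ Set.Ico (gridPoint j) (gridPointSucc j)) : gridIndex hk x = j := by
  have hk' : (0 : ℝ) < k := by exact_mod_cast hk
  obtain ⟨h1, h2⟩ := hx
  rw [← Subtype.coe_le_coe] at h1
  rw [← Subtype.coe_lt_coe] at h2
  simp only [gridPoint, gridPointSucc] at h1 h2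
  rw [div_le_iff₀' hk'] at h1
  rw [lt_div_iff₀' hk'] at h2
  have : ⌊(k : ℝ) * x⌋₊ = j := (Nat.floor_eq_iff (by linarith [(j : ℕ).cast_nonneg (α := ℝ)])).mpr ⟨h1, h2⟩
  ext
  simp only [gridIndex, this]
  omega

theorem volume_gridIndex_preimage {k : ℕ} (hk : 0 < k) (j : Fin k) :
    volume (gridIndex hk ⁻¹' {j}) = ENNReal.ofReal (1 / k) := by
  have h : ((gridPointSucc j : unitInterval) : ℝ) - (gridPoint j : unitInterval) = 1 / k := by
    simp only [gridPoint, gridPointSucc]; ring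
  refine le_antisymm ?_ ?_
  · rw [← h, ← unitInterval.volume_Icc]
    refine measure_mono ?_
    rintro x rfl
    exact mem_Icc_gridIndex hk x
  · rw [← h, ← unitInterval.volume_Ico]
    exact measure_mono fun x hx => gridIndex_eq_of_mem_Ico hk hx

/-- The multi-index of the grid cell containing a point of the cube. -/
noncomputable def cellIndex {p k : ℕ} (hk : 0 < k) (x : Cube p) : Fin p → Fin k :=
  fun l => gridIndex hk (x l)

/-- The lower corner of a grid cell. -/
noncomputable def cellCorner {p k : ℕ} (c : Fin p → Fin k) : Cube p := fun l => gridPoint (c l)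

theorem coe_cellCorner {p k : ℕ} (c : Fin p → Fin k) (l : Fin p) :
    ((cellCorner c l : unitInterval) : ℝ) = (c l : ℝ) / k := rfl

theorem cellCorner_cellIndex_le {p k : ℕ} (hk : 0 < k) (x : Cube p) (l : Fin p) :
    (cellCorner (cellIndex hk x) l : ℝ) ≤ x l ∧
      (x l : ℝ) ≤ cellCorner (cellIndex hk x) l + 1 / k := by
  have h := mem_Icc_gridIndex hk (x l)
  refine ⟨h.1, ?_⟩
  have h2 : (x l : ℝ) ≤ _ := h.2
  simp only [gridPointSucc, add_div] at h2
  exact h2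

theorem measurable_cellIndex {p k : ℕ} (hk : 0 < k) : Measurable (cellIndex (p := p) hk) :=
  measurable_pi_lambda _ fun l => (measurable_gridIndex hk).comp (measurable_pi_apply l)

theorem volume_cellIndex_preimage {p k : ℕ} (hk : 0 < k) (c : Fin p → Fin k) :
    (volume : Measure (Cube p)) (cellIndex hk ⁻¹' {c}) = ENNReal.ofReal ((1 / k) ^ p) := by
  have h : (cellIndex hk ⁻¹' {c} : Set (Cube p)) =
      Set.pi Set.univ fun l => gridIndex hk ⁻¹' {c l} := by
    ext x; simp [cellIndex, funext_iff, Set.mem_pi]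
  rw [h, volume_pi_pi]
  simp_rw [volume_gridIndex_preimage hk]
  rw [Finset.prod_const, Finset.card_univ, Fintype.card_fin, ENNReal.ofReal_pow (by positivity)]

/-- The image of Lebesgue measure under `cellIndex` is uniform on the `k^p` indices, so a Riemann
sum is the integral of a step function. -/
theorem integral_comp_cellIndex {p k : ℕ} (hk : 0 < k) (g : (Fin p → Fin k) → ℝ) :
    ∫ x : Cube p, g (cellIndex hk x) = ∑ c, (1 / (k : ℝ)) ^ p * g c := by
  have hm := measurable_cellIndex (p := p) hk
  rw [← integral_map hm.aemeasurable (f := g) (measurable_of_countable g).aestronglyMeasurable]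
  have : IsProbabilityMeasure ((volume : Measure (Cube p)).map (cellIndex hk)) :=
    Measure.isProbabilityMeasure_map hm.aemeasurable
  rw [integral_fintype (Integrable.of_finite)]
  refine Finset.sum_congr rfl fun c _ => ?_
  rw [Measure.real, Measure.map_apply hm (measurableSet_singleton _),
    volume_cellIndex_preimage, ENNReal.toReal_ofReal (by positivity), smul_eq_mul]

theorem dist_cellCorner_le {p k : ℕ} {x : Cube p} {c : Fin p → Fin k}
    (h : ∀ l, (cellCorner c l : ℝ) ≤ x l ∧ (x l : ℝ) ≤ cellCorner c l + 1 / k) :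
    dist x (cellCorner c) ≤ 1 / k := by
  rw [dist_pi_le_iff (by positivity)]
  intro l
  rw [Subtype.dist_eq, Real.dist_eq, abs_le]
  have := h l
  have : (0 : ℝ) ≤ 1 / k := by positivity
  constructor <;> linarith

/-- A continuous function varies little on the cells of fine grids. -/
theorem eventually_abs_sub_cellCorner_lt {p : ℕ} {g : Cube p → ℝ} (hg : Continuous g) {ε : ℝ}
    (hε : 0 < ε) : ∀ᶠ k : ℕ in atTop, ∀ (x : Cube p) (c : Fin p → Fin k),
      (∀ l, (cellCorner c l : ℝ) ≤ x l ∧ (x l : ℝ) ≤ cellCorner c l + 1 / k) →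
      |g x - g (cellCorner c)| < ε := by
  obtain ⟨δ, hδ, h⟩ := Metric.uniformContinuous_iff.mp
    (CompactSpace.uniformContinuous_of_continuous hg) ε hε
  have h1 : Tendsto (fun k : ℕ => 1 / (k : ℝ)) atTop (𝓝 0) :=
    tendsto_one_div_atTop_nhds_zero_nat
  filter_upwards [h1.eventually_lt_const hδ] with k hk x c hx
  rw [← Real.dist_eq]
  exact h ((dist_cellCorner_le hx).trans_lt hk)

theorem tendsto_riemannSum {p : ℕ} {g : Cube p → ℝ} (hg : Continuous g) :
    Tendsto (fun k : ℕ => ∑ c : Fin p → Fin k, (1 / (k : ℝ)) ^ p * g (cellCorner c)) atTop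
      (𝓝 (∫ x, g x)) := by
  rw [Metric.tendsto_nhds]
  intro ε hε
  filter_upwards [eventually_abs_sub_cellCorner_lt hg (half_pos hε), eventually_gt_atTop 0]
    with k hk hk0
  rw [← integral_comp_cellIndex hk0 fun c => g (cellCorner c), Real.dist_eq, ← integral_sub]
  · have h := norm_integral_le_of_norm_le_const (μ := (volume : Measure (Cube p))) (C := ε / 2)
      (f := fun x => g (cellCorner (cellIndex hk0 x)) - g x) (ae_of_all _ fun x => by
        rw [Real.norm_eq_abs, abs_sub_comm]
        exact (hk x _ (cellCorner_cellIndex_le hk0 x)).le)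
    simp only [probReal_univ, mul_one, Real.norm_eq_abs] at h
    linarith
  · exact Integrable.comp_measurable (g := fun c => g (cellCorner c)) Integrable.of_finite (measurable_cellIndex hk0)
  · exact hg.integrable_of_hasCompactSupport (HasCompactSupport.of_compactSpace g)

/-! ### Upper bound for designs with large pair values. -/

/-- Every pair of points of the design contributes at least `r` to the criterion. -/
def PairValuesGE {p : ℕ} {ι : Type*} (s : ℝ) (w : Cube p → ℝ) (r : ℝ) (D : ι → Cube p) : Prop :=
  Pairwise fun i j => r ≤ w (D i) * w (D j) * genDist s (D i) (D j)

theorem genDist_eq_powerDist {p : ℕ} (s : ℝ) (u v : Cube p) :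
    genDist s u v = powerDist s (fun l => (u l : ℝ)) (fun l => (v l : ℝ)) := rfl

/-- For `n ≤ 1` the infimum is over an empty type and takes the default value `0`, hence `2 ≤ n`. -/
theorem le_medCriterion_iff {p n : ℕ} (hn : 2 ≤ n) {s r : ℝ} {w : Cube p → ℝ}
    {D : Fin n → Cube p} : r ≤ medCriterion s w D ↔ PairValuesGE s w r D := by
  have hne : Nonempty {e : Fin n × Fin n // e.1 ≠ e.2} :=
    ⟨⟨(⟨0, by omega⟩, ⟨1, by omega⟩), by simp⟩⟩
  unfold medCriterion
  rw [le_ciInf_iff (Set.finite_range _).bddBelow]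
  exact ⟨fun h i j hij => h ⟨(i, j), hij⟩, fun h e => h e.2⟩

/-- The point `x` lies in the closed grid cell with index `c`. -/
def InCell {p k : ℕ} (c : Fin p → Fin k) (x : Cube p) : Prop :=
  ∀ l, (cellCorner c l : ℝ) ≤ x l ∧ (x l : ℝ) ≤ cellCorner c l + 1 / k

theorem exists_pos_lower_bound {p : ℕ} {w : Cube p → ℝ} (hw : Continuous w) (hpos : ∀ x, 0 < w x) :
    ∃ m, 0 < m ∧ ∀ x, m ≤ w x := by
  obtain ⟨x₀, -, h⟩ := isCompact_univ.exists_isMinOn Set.univ_nonempty hw.continuousOn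
  exact ⟨w x₀, hpos x₀, fun x => h (Set.mem_univ x)⟩

/-- Since `w ≥ m > 0`, an additive error `δ * m` is a relative error of at most `δ`. -/
theorem eventually_le_mul_cellCorner {p : ℕ} {w : Cube p → ℝ} (hw : Continuous w)
    (hpos : ∀ x, 0 < w x) {δ : ℝ} (hδ : 0 < δ) : ∀ᶠ k : ℕ in atTop, ∀ (x : Cube p)
      (c : Fin p → Fin k), InCell c x →
      w x ≤ (1 + δ) * w (cellCorner c) ∧ w (cellCorner c) ≤ (1 + δ) * w x := by
  obtain ⟨m, hm, hmw⟩ := exists_pos_lower_bound hw hpos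
  filter_upwards [eventually_abs_sub_cellCorner_lt hw (mul_pos hδ hm)] with k hk x c hx
  have h := abs_lt.mp (hk x c hx)
  have h1 := mul_le_mul_of_nonneg_left (hmw x) hδ.le
  have h2 := mul_le_mul_of_nonneg_left (hmw (cellCorner c)) hδ.le
  constructor <;> linarith

theorem sum_le_sum_packingNumber {p : ℕ} (hp : 1 ≤ p) {s : ℝ} (hs : 0 < s) {w φ : Cube p → ℝ}
    (hpos : ∀ x, 0 < w x) (hφ : ∀ x, 0 ≤ φ x) {δ r : ℝ} (hδ : 0 < δ) (hr : 0 < r) {k : ℕ}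
    (hk : 0 < k)
    (hwk : ∀ (x : Cube p) (c : Fin p → Fin k), InCell c x → w x ≤ (1 + δ) * w (cellCorner c))
    (hφk : ∀ (x : Cube p) (c : Fin p → Fin k), InCell c x → φ x ≤ φ (cellCorner c) + δ)
    {n : ℕ} {D : Fin n → Cube p} (hD : PairValuesGE s w r D) :
    ∑ i, φ (D i) ≤ ∑ c : Fin p → Fin k, (φ (cellCorner c) + δ) *
      packingNumber p s (1 / k * ((1 + δ) * w (cellCorner c)) ^ 2 / r) := by
  classical
  rw [← Finset.sum_fiberwise Finset.univ (fun i => cellIndex hk (D i)) (fun i => φ (D i))]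
  refine Finset.sum_le_sum fun c _ => ?_
  have hcell : ∀ i, cellIndex hk (D i) = c → InCell c (D i) := by
    rintro i rfl
    exact cellCorner_cellIndex_le hk (D i)
  have hwc : 0 < (1 + δ) * w (cellCorner c) := mul_pos (by linarith) (hpos _)
  have hcard := card_le_packingNumber hp hs (ι := {i // cellIndex hk (D i) = c})
    (x := fun i l => (D i l : ℝ)) (b := fun l => cellCorner c l) (h := 1 / k)
    (t := r / ((1 + δ) * w (cellCorner c)) ^ 2) (by positivity)
    (fun i l => hcell i i.2 l) (fun i j hij => by
      have h1 : r ≤ w (D i) * w (D j) * genDist s (D i) (D j) :=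
        hD (Subtype.coe_injective.ne hij)
      rw [genDist_eq_powerDist] at h1
      refine (div_le_iff₀' (by positivity)).mpr ?_
      refine h1.trans ?_
      refine mul_le_mul_of_nonneg_right ?_ (powerDist_nonneg _ _ _)
      rw [sq]
      exact mul_le_mul (hwk _ _ (hcell i i.2)) (hwk _ _ (hcell j j.2)) (hpos _).le hwc.le)
  rw [Fintype.card_subtype, div_div_eq_mul_div] at hcard
  calc ∑ i with cellIndex hk (D i) = c, φ (D i)
      ≤ ∑ i with cellIndex hk (D i) = c, (φ (cellCorner c) + δ) :=
        Finset.sum_le_sum fun i hi => hφk _ _ (hcell i (by simpa using hi))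
    _ = (φ (cellCorner c) + δ) * (Finset.univ.filter fun i => cellIndex hk (D i) = c).card := by
        rw [Finset.sum_const, nsmul_eq_mul, mul_comm]
    _ ≤ _ := by
        have := hφ (cellCorner c)
        gcongr

theorem integrable_of_continuous {p : ℕ} {g : Cube p → ℝ} (hg : Continuous g) :
    Integrable g :=
  hg.integrable_of_hasCompactSupport (HasCompactSupport.of_compactSpace g)

/-- The parameters are fixed in the order `δ`, `k`, `r`. With `k` fixed there are finitely many
cells, so the limit `r → 0` is taken term by term, uniformly in `n` and `D`. -/
theorem eventually_pow_mul_sum_lt {p : ℕ} (hp : 1 ≤ p) {s : ℝ} (hs : 0 < s) {Δ : ℝ}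
    (hΔ : Tendsto (fun a : ℝ => packingNumber p s a / a ^ p) atTop (𝓝 Δ))
    {w φ : Cube p → ℝ} (hw : Continuous w) (hpos : ∀ x, 0 < w x) (hφ : Continuous φ)
    (hφ0 : ∀ x, 0 ≤ φ x) {Y : ℝ} (hY : Δ * ∫ x, φ x * w x ^ (2 * p) < Y) :
    ∀ᶠ r in 𝓝[>] (0 : ℝ), ∀ (n : ℕ) (D : Fin n → Cube p), PairValuesGE s w r D →
      r ^ p * ∑ i, φ (D i) < Y := by
  have hint : ∀ δ : ℝ, ∫ x, (φ x + δ) * w x ^ (2 * p) =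
      (∫ x, φ x * w x ^ (2 * p)) + δ * ∫ x, w x ^ (2 * p) := by
    intro δ
    rw [← integral_const_mul, ← integral_add (integrable_of_continuous (by fun_prop))
      (integrable_of_continuous (by fun_prop))]
    simp_rw [add_mul]
  have hcont : Continuous fun δ : ℝ =>
      Δ * (1 + δ) ^ (2 * p) * ∫ x, (φ x + δ) * w x ^ (2 * p) := by
    simp_rw [hint]; fun_prop
  have hlim := (hcont.tendsto 0).mono_left (nhdsWithin_le_nhds (s := Set.Ioi (0 : ℝ)))
  simp only [add_zero, one_pow, mul_one] at hlim
  obtain ⟨δ, hδY, hδ⟩ := ((hlim.eventually_lt_const hY).and self_mem_nhdsWithin).exists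
  replace hδ : 0 < δ := hδ
  have hR := (tendsto_riemannSum (g := fun x => (φ x + δ) * w x ^ (2 * p))
    (by fun_prop)).const_mul (Δ * (1 + δ) ^ (2 * p))
  obtain ⟨k, hkY, hkw, hkφ, hk⟩ := ((hR.eventually_lt_const hδY).and
    ((eventually_le_mul_cellCorner hw hpos hδ).and
      ((eventually_abs_sub_cellCorner_lt hφ hδ).and (eventually_gt_atTop 0)))).exists
  have hk' : (0 : ℝ) < k := by exact_mod_cast hk
  have hr : Tendsto (fun r : ℝ => ∑ c : Fin p → Fin k, (φ (cellCorner c) + δ) *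
      (r ^ p * packingNumber p s (1 / k * ((1 + δ) * w (cellCorner c)) ^ 2 / r))) (𝓝[>] 0)
      (𝓝 (∑ c : Fin p → Fin k, (φ (cellCorner c) + δ) *
        (Δ * (1 / k * ((1 + δ) * w (cellCorner c)) ^ 2) ^ p))) := by
    refine tendsto_finsetSum _ fun c _ => Tendsto.const_mul _ ?_
    have := hpos (cellCorner c)
    exact tendsto_pow_mul_packingNumber hΔ (by positivity) tendsto_const_nhds
  have hsum : ∑ c : Fin p → Fin k, (φ (cellCorner c) + δ) *
        (Δ * (1 / k * ((1 + δ) * w (cellCorner c)) ^ 2) ^ p) < Y := by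
    refine lt_of_eq_of_lt ?_ hkY
    rw [Finset.mul_sum]
    refine Finset.sum_congr rfl fun c _ => ?_
    rw [mul_pow, ← pow_mul, mul_pow]
    ring
  filter_upwards [hr.eventually_lt_const hsum, self_mem_nhdsWithin] with r hrY hr0 n D hD
  replace hr0 : 0 < r := hr0
  refine lt_of_le_of_lt ?_ hrY
  have h := sum_le_sum_packingNumber hp hs hpos hφ0 hδ hr0 hk (fun x c h => (hkw x c h).1)
    (fun x c h => by linarith [abs_lt.mp (hkφ x c h)]) hD
  refine (mul_le_mul_of_nonneg_left h (by positivity : 0 ≤ r ^ p)).trans_eq ?_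
  rw [Finset.mul_sum]
  exact Finset.sum_congr rfl fun c _ => mul_left_comm _ _ _

/-! ### Construction of designs from packings of shrunk cells. -/

theorem le_abs_sub_of_mem_shrunk_cells {i j k : ℕ} (hij : i ≠ j) {x y g : ℝ}
    (hx : (i : ℝ) / k ≤ x ∧ x ≤ i / k + (1 / k - g))
    (hy : (j : ℝ) / k ≤ y ∧ y ≤ j / k + (1 / k - g)) : g ≤ |x - y| := by
  rcases lt_or_gt_of_ne hij with h | h
  · have h1 : ((i : ℝ) + 1) / k ≤ j / k := by
      gcongr; exact_mod_cast h
    rw [add_div] at h1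
    rw [abs_sub_comm]
    exact le_trans (by linarith) (le_abs_self _)
  · have h1 : ((j : ℝ) + 1) / k ≤ i / k := by
      gcongr; exact_mod_cast h
    rw [add_div] at h1
    exact le_trans (by linarith) (le_abs_self _)

theorem exists_design_of_le_sum {p : ℕ} (hp : 1 ≤ p) {s : ℝ} (hs : 0 < s) {w : Cube p → ℝ}
    {m : ℝ} (hm : 0 < m) (hmw : ∀ x, m ≤ w x) {δ r : ℝ} (hδ : 0 < δ) (hr : 0 < r) {k : ℕ}
    (hwk : ∀ (x : Cube p) (c : Fin p → Fin k), InCell c x → w (cellCorner c) ≤ (1 + δ) * w x)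
    {n : ℕ} (hn : n ≤ ∑ c : Fin p → Fin k, packingNumber p s
      ((1 / k - r * ((p : ℝ) ^ (1 / s) / m ^ 2)) * (w (cellCorner c) / (1 + δ)) ^ 2 / r)) :
    ∃ D : Fin n → Cube p, PairValuesGE s w r D := by
  have hpos : ∀ x, 0 < w x := fun x => hm.trans_le (hmw x)
  have hp' : (0 : ℝ) < p := by exact_mod_cast hp
  -- A gap `r * G` between cells forces `d_s ≥ r / m²` for points of different cells, and `w ≥ m`
  -- then makes their pair value at least `r`.
  set G := (p : ℝ) ^ (1 / s) / m ^ 2 with hG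
  have hG0 : 0 < G := by positivity
  have ht : ∀ c : Fin p → Fin k, 0 < r / (w (cellCorner c) / (1 + δ)) ^ 2 := fun c => by
    have := hpos (cellCorner c); positivity
  choose x hbox hsep using fun c : Fin p → Fin k =>
    exists_packing hp hs (fun l => (cellCorner c l : ℝ)) (h := 1 / k - r * G) (ht c)
  have hin : ∀ c i l, (cellCorner c l : ℝ) ≤ x c i l ∧ x c i l ≤ cellCorner c l + 1 / k := by
    intro c i l
    have := hbox c i l
    exact ⟨this.1, by nlinarith [this.2]⟩
  have hunit : ∀ c i l, x c i l ∈ unitInterval := by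
    intro c i l
    refine ⟨(cellCorner c l).2.1.trans (hin c i l).1, (hin c i l).2.trans ?_⟩
    rw [coe_cellCorner, ← add_div]
    exact div_le_one_of_le₀ (by exact_mod_cast (c l).2) (by positivity)
  let E : (Σ c, Fin (packingNumber p s ((1 / k - r * G) / (r / (w (cellCorner c) / (1 + δ)) ^ 2))))
      → Cube p := fun e l => ⟨x e.1 e.2 l, hunit _ _ _⟩
  have hE : PairValuesGE s w r E := by
    rintro ⟨c, i⟩ ⟨d, j⟩ hne
    rw [genDist_eq_powerDist]
    have hd0 := powerDist_nonneg s (x c i) (x d j)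
    by_cases hcd : c = d
    · subst hcd
      have hij : i ≠ j := fun h => hne (by rw [h])
      have h1 : r / (w (cellCorner c) / (1 + δ)) ^ 2 ≤ powerDist s (x c i) (x c j) := hsep c hij
      have hwc := hpos (cellCorner c)
      rw [div_le_iff₀' (by positivity)] at h1
      refine h1.trans (mul_le_mul_of_nonneg_right ?_ hd0)
      have h2 : ∀ i, w (cellCorner c) / (1 + δ) ≤ w (E ⟨c, i⟩) := fun i => by
        rw [div_le_iff₀' (by positivity)]
        exact hwk _ c (hin c i)
      rw [sq]
      exact mul_le_mul (h2 i) (h2 j) (by positivity) (hpos _).le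
    · obtain ⟨l, hl⟩ := Function.ne_iff.mp hcd
      have h1 := le_abs_sub_of_mem_shrunk_cells (fun h => hl (Fin.ext h)) (hbox c i l) (hbox d j l)
      have h2 := h1.trans (abs_sub_le_powerDist hs (x c i) (x d j) l)
      have h3 : r ≤ m * m * powerDist s (x c i) (x d j) := by
        have hpp : 0 < (p : ℝ) ^ (1 / s) := by positivity
        have h4 : r * G * m ^ 2 = r * (p : ℝ) ^ (1 / s) := by rw [hG]; field_simp
        have h5 := mul_le_mul_of_nonneg_right h2 (sq_nonneg m)
        rw [h4] at h5
        refine le_of_mul_le_mul_right ?_ hpp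
        linarith
      refine h3.trans (mul_le_mul_of_nonneg_right ?_ hd0)
      exact mul_le_mul (hmw _) (hmw _) hm.le (hpos _).le
  -- Any `n` of the constructed points will do: the pair condition passes to subfamilies.
  obtain ⟨f⟩ : Nonempty (Fin n ↪ _) := Function.Embedding.nonempty_of_card_le (α := Fin n)
    (β := Σ c, Fin (packingNumber p s ((1 / k - r * G) / (r / (w (cellCorner c) / (1 + δ)) ^ 2))))
    (by simpa [Fintype.card_sigma, div_div_eq_mul_div] using hn)
  exact ⟨E ∘ f, fun i j hij => hE (f.injective.ne hij)⟩

theorem eventually_exists_design {p : ℕ} (hp : 1 ≤ p) {s : ℝ} (hs : 0 < s) {Δ : ℝ}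
    (hΔ : Tendsto (fun a : ℝ => packingNumber p s a / a ^ p) atTop (𝓝 Δ))
    {w : Cube p → ℝ} (hw : Continuous w) (hpos : ∀ x, 0 < w x) {Y : ℝ}
    (hY : Y < Δ * ∫ x, w x ^ (2 * p)) :
    ∀ᶠ r in 𝓝[>] (0 : ℝ), ∀ n : ℕ, r ^ p * n ≤ Y →
      ∃ D : Fin n → Cube p, PairValuesGE s w r D := by
  obtain ⟨m, hm, hmw⟩ := exists_pos_lower_bound hw hpos
  have hlim : Tendsto (fun δ : ℝ => Δ * (1 / (1 + δ)) ^ (2 * p) * ∫ x, w x ^ (2 * p)) (𝓝[>] 0)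
      (𝓝 (Δ * (1 / (1 + 0)) ^ (2 * p) * ∫ x, w x ^ (2 * p))) := by
    refine tendsto_nhdsWithin_of_tendsto_nhds ?_
    refine ((tendsto_const_nhds.mul (Tendsto.pow (tendsto_const_nhds.div
      (tendsto_const_nhds.add tendsto_id) ?_) _)).mul tendsto_const_nhds)
    norm_num
  simp only [add_zero, div_one, one_pow, mul_one] at hlim
  obtain ⟨δ, hδY, hδ⟩ := ((hlim.eventually_const_lt hY).and self_mem_nhdsWithin).exists
  replace hδ : 0 < δ := hδ
  have hR := (tendsto_riemannSum (g := fun x => w x ^ (2 * p))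
    (by fun_prop)).const_mul (Δ * (1 / (1 + δ)) ^ (2 * p))
  obtain ⟨k, hkY, hkw, hk⟩ := ((hR.eventually_const_lt hδY).and
    ((eventually_le_mul_cellCorner hw hpos hδ).and (eventually_gt_atTop 0))).exists
  have hk' : (0 : ℝ) < k := by exact_mod_cast hk
  have hr : Tendsto (fun r : ℝ => ∑ c : Fin p → Fin k, r ^ p * (packingNumber p s
      ((1 / k - r * ((p : ℝ) ^ (1 / s) / m ^ 2)) * (w (cellCorner c) / (1 + δ)) ^ 2 / r) : ℝ))
      (𝓝[>] 0)
      (𝓝 (∑ c : Fin p → Fin k, Δ * (1 / k * (w (cellCorner c) / (1 + δ)) ^ 2) ^ p)) := by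
    refine tendsto_finsetSum _ fun c _ => ?_
    have := hpos (cellCorner c)
    refine tendsto_pow_mul_packingNumber (β := fun r => (1 / k - r * ((p : ℝ) ^ (1 / s) / m ^ 2)) *
      (w (cellCorner c) / (1 + δ)) ^ 2) hΔ (by positivity) ?_
    refine tendsto_nhdsWithin_of_tendsto_nhds ?_
    have hc : Continuous fun r : ℝ => (1 / k - r * ((p : ℝ) ^ (1 / s) / m ^ 2)) *
      (w (cellCorner c) / (1 + δ)) ^ 2 := by fun_prop
    simpa using hc.tendsto 0
  have hsum : Y < ∑ c : Fin p → Fin k, Δ * (1 / k * (w (cellCorner c) / (1 + δ)) ^ 2) ^ p := by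
    refine lt_of_lt_of_eq hkY ?_
    rw [Finset.mul_sum]
    refine Finset.sum_congr rfl fun c _ => ?_
    rw [mul_pow, ← pow_mul, div_eq_mul_one_div (w _), mul_pow]
    ring
  filter_upwards [hr.eventually_const_lt hsum, self_mem_nhdsWithin] with r hrY hr0 n hn
  replace hr0 : 0 < r := hr0
  refine exists_design_of_le_sum hp hs hm hmw hδ hr0 (fun x c h => (hkw x c h).2) ?_
  have h1 := hn.trans hrY.le
  rw [← Finset.mul_sum] at h1
  exact_mod_cast le_of_mul_le_mul_left h1 (by positivity)

/-! ### Comparison of the two bounds and weak convergence. -/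

theorem integral_pow_pos {p : ℕ} {w : Cube p → ℝ} (hw : Continuous w) (hpos : ∀ x, 0 < w x) :
    0 < ∫ x, w x ^ (2 * p) := by
  obtain ⟨m, hm, hmw⟩ := exists_pos_lower_bound hw hpos
  calc 0 < m ^ (2 * p) := by positivity
    _ = ∫ _x : Cube p, m ^ (2 * p) := by simp
    _ ≤ _ := integral_mono (integrable_const _) (integrable_of_continuous (by fun_prop))
      fun x => pow_le_pow_left₀ hm.le (hmw x) _

theorem eventually_mean_lt {p : ℕ} (hp : 1 ≤ p) {s : ℝ} (hs : 0 < s) {w φ : Cube p → ℝ}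
    (hw : Continuous w) (hpos : ∀ x, 0 < w x) (hφ : Continuous φ) (hφ0 : ∀ x, 0 ≤ φ x)
    {D : (n : ℕ+) → (Fin n → Cube p)} (hD : ∀ n, IsMED s w (D n)) {Y : ℝ}
    (hY : (∫ x, φ x * w x ^ (2 * p)) / ∫ x, w x ^ (2 * p) < Y) :
    ∀ᶠ n : ℕ+ in atTop, (n : ℝ)⁻¹ * ∑ i, φ (D n i) < Y := by
  obtain ⟨Δ, hΔ0, hΔ⟩ := exists_packing_density hp hs
  have hZ := integral_pow_pos hw hpos
  set Z := ∫ x, w x ^ (2 * p)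
  set A := ∫ x, φ x * w x ^ (2 * p)
  -- `η` is the error allowed in both bounds; it is chosen so that their ratio stays below `Y`.
  have hlim : Tendsto (fun η : ℝ => (Δ * A + η) / (Δ * Z - η)) (𝓝[>] 0)
      (𝓝 ((Δ * A + 0) / (Δ * Z - 0))) := by
    refine tendsto_nhdsWithin_of_tendsto_nhds ?_
    refine (tendsto_const_nhds.add tendsto_id).div (tendsto_const_nhds.sub tendsto_id) ?_
    simp only [sub_zero]; positivity
  rw [add_zero, sub_zero, mul_div_mul_left _ _ hΔ0.ne'] at hlim
  obtain ⟨η, hηY, hη, hηZ⟩ := ((hlim.eventually_lt_const hY).and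
    (Ioo_mem_nhdsGT (mul_pos hΔ0 hZ))).exists
  have hB : 0 < Δ * Z - η := by linarith
  set B := Δ * Z - η with hB_def
  have hpne : p ≠ 0 := by omega
  have hp' : (0 : ℝ) < 1 / p := by
    have : (0 : ℝ) < p := by exact_mod_cast hp
    positivity
  have hcast : Tendsto (fun n : ℕ+ => ((n : ℕ) : ℝ)) atTop atTop :=
    tendsto_natCast_atTop_atTop.comp tendsto_PNat_val_atTop_atTop
  -- The choice `r = (B / n)^(1/p)` gives `r^p * n = B`, the most that the construction allows at
  -- level `B`.
  have hr : Tendsto (fun n : ℕ+ => (B / (n : ℝ)) ^ (1 / (p : ℝ))) atTop (𝓝[>] 0) := by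
    refine tendsto_nhdsWithin_iff.mpr ⟨?_, Eventually.of_forall fun n => ?_⟩
    · have h1 : Tendsto (fun n : ℕ+ => B / ((n : ℕ) : ℝ)) atTop (𝓝 0) :=
        tendsto_const_nhds.div_atTop hcast
      have h2 := h1.rpow_const (p := 1 / (p : ℝ)) (Or.inr hp'.le)
      rwa [Real.zero_rpow hp'.ne'] at h2
    · have : (0 : ℝ) < n := by exact_mod_cast n.pos
      exact Set.mem_Ioi.mpr (by positivity)
  filter_upwards [hr.eventually (eventually_pow_mul_sum_lt hp hs hΔ hw hpos hφ hφ0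
      (Y := Δ * A + η) (by linarith)),
    hr.eventually (eventually_exists_design hp hs hΔ hw hpos (Y := B) (by linarith)),
    eventually_ge_atTop (2 : ℕ+)] with n hup hlow hn
  have hn' : (0 : ℝ) < n := by exact_mod_cast n.pos
  have hn2 : 2 ≤ (n : ℕ) := by exact_mod_cast hn
  have hrp : ((B / (n : ℝ)) ^ (1 / (p : ℝ))) ^ p = B / n := by
    rw [one_div, Real.rpow_inv_natCast_pow (by positivity) hpne]
  rw [hrp] at hup hlow
  obtain ⟨D', hD'⟩ := hlow n (by rw [div_mul_cancel₀ _ hn'.ne'])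
  have h1 := hup n (D n) ((le_medCriterion_iff hn2).mp
    (((le_medCriterion_iff hn2).mpr hD').trans (hD n D')))
  refine lt_of_lt_of_le ?_ hηY.le
  rw [lt_div_iff₀ hB]
  calc _ = B / n * ∑ i, φ (D n i) := by ring
    _ < _ := h1

theorem integral_empiricalMeasure {p : ℕ} {n : ℕ+} (D : Fin n → Cube p) (φ : Cube p → ℝ) :
    ∫ x, φ x ∂(empiricalMeasure D : Measure (Cube p)) = (n : ℝ)⁻¹ * ∑ i, φ (D i) := by
  simp only [empiricalMeasure, ProbabilityMeasure.coe_mk]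
  rw [integral_smul_measure, integral_finsetSum_measure]
  · simp
  · intro i _
    exact integrable_dirac (by simp)

/-- Empirical measures of minimum energy designs for a continuous weight `w` converge weakly to the
probability measure with density proportional to `w ^ (2 * p)`. -/
theorem exists_tendsto_empiricalMeasure {p : ℕ} (hp : 1 ≤ p) {w : Cube p → ℝ} (hw : Continuous w)
    (hpos : ∀ x, 0 < w x) :
    ∃ P : ProbabilityMeasure (Cube p),
      (∀ s : ℝ, 0 < s → ∀ D : (n : ℕ+) → (Fin n → Cube p), (∀ n, IsMED s w (D n)) →
        Tendsto (fun n => empiricalMeasure (D n)) atTop (𝓝 P)) ∧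
      HasNormalizedDensity P fun x => w x ^ (2 * p) := by
  have hZ := integral_pow_pos hw hpos
  set Z := ∫ x, w x ^ (2 * p) with hZ_def
  have hρ : Continuous fun x => w x ^ (2 * p) / Z := by fun_prop
  have hρ0 : ∀ x, 0 ≤ w x ^ (2 * p) / Z := fun x => by have := hpos x; positivity
  have hprob : IsProbabilityMeasure ((volume : Measure (Cube p)).withDensity
      fun x => ENNReal.ofReal (w x ^ (2 * p) / Z)) := by
    refine ⟨?_⟩
    rw [withDensity_apply _ MeasurableSet.univ, Measure.restrict_univ,
      ← ofReal_integral_eq_lintegral_ofReal (integrable_of_continuous hρ) (ae_of_all _ hρ0),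
      integral_div, div_self hZ.ne', ENNReal.ofReal_one]
  let P : ProbabilityMeasure (Cube p) := ⟨_, hprob⟩
  refine ⟨P, ?_, rfl⟩
  intro s hs D hD
  have hint : ∀ φ : Cube p → ℝ, ∫ x, φ x ∂((volume : Measure (Cube p)).withDensity
      fun x => ENNReal.ofReal (w x ^ (2 * p) / Z)) = (∫ x, φ x * w x ^ (2 * p)) / Z := by
    intro φ
    rw [integral_withDensity_eq_integral_toReal_smul hρ.measurable.ennreal_ofReal
      (ae_of_all _ fun _ => ENNReal.ofReal_lt_top), ← integral_div]
    refine integral_congr_ae (ae_of_all _ fun x => ?_)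
    simp only [ENNReal.toReal_ofReal (hρ0 x), smul_eq_mul]
    ring
  -- Adding a constant `C` reduces to nonnegative functions, as both sides average with total mass
  -- one.
  have hupper : ∀ φ : Cube p → ℝ, Continuous φ → ∀ C, (∀ x, 0 ≤ C + φ x) → ∀ Y,
      (∫ x, φ x * w x ^ (2 * p)) / Z < Y →
      ∀ᶠ n : ℕ+ in atTop, (n : ℝ)⁻¹ * ∑ i, φ (D n i) < Y := by
    intro φ hφ C hC Y hY
    have h1 : ∫ x, (C + φ x) * w x ^ (2 * p) = C * Z + ∫ x, φ x * w x ^ (2 * p) := by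
      simp_rw [add_mul]
      rw [integral_add (integrable_of_continuous (by fun_prop))
        (integrable_of_continuous (by fun_prop)), integral_const_mul]
    filter_upwards [eventually_mean_lt hp hs hw hpos (φ := fun x => C + φ x) (by fun_prop) hC hD
      (Y := C + Y) (by rw [h1, ← hZ_def, add_div, mul_div_cancel_right₀ _ hZ.ne']; linarith)]
      with n hn
    have hn' : (n : ℝ) ≠ 0 := by exact_mod_cast n.ne_zero
    rw [Finset.sum_add_distrib, mul_add] at hn
    simp only [Finset.sum_const, Finset.card_univ, Fintype.card_fin, nsmul_eq_mul] at hn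
    rw [inv_mul_cancel_left₀ hn'] at hn
    linarith
  rw [ProbabilityMeasure.tendsto_iff_forall_integral_tendsto]
  intro f
  simp only [integral_empiricalMeasure, P, ProbabilityMeasure.coe_mk, hint]
  have hf : ∀ x, |f x| ≤ ‖f‖ := f.norm_coe_le_norm
  refine tendsto_order.mpr ⟨fun y hy => ?_, fun y hy => ?_⟩
  -- The upper bound for `-f` is the lower bound for `f`.
  · have h := hupper (fun x => -f x) (by fun_prop) ‖f‖
      (fun x => by linarith [(abs_le.mp (hf x)).2]) (-y)
      (by simp only [neg_mul, integral_neg, neg_div]; linarith)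
    filter_upwards [h] with n hn
    simp only [Finset.sum_neg_distrib, mul_neg] at hn
    linarith
  · exact hupper f f.continuous ‖f‖ (fun x => by linarith [(abs_le.mp (hf x)).1]) y hy

/-- The metric on `Cube p` is the sup metric, so continuity comes from `euclidDist u x → 0` as `u →
x`. -/
theorem LipschitzOnCube.continuous {p : ℕ} {q : Cube p → ℝ} (hq : LipschitzOnCube q) :
    Continuous q := by
  obtain ⟨L, hL, h⟩ := hq
  rw [continuous_iff_continuousAt]
  intro x
  refine tendsto_iff_dist_tendsto_zero.mpr ?_
  have hd : Continuous fun u : Cube p => L * euclidDist u x := by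
    unfold euclidDist; fun_prop
  have h0 := hd.tendsto x
  simp only [euclidDist, sub_self, ne_eq, OfNat.ofNat_ne_zero, not_false_eq_true, zero_pow,
    Finset.sum_const_zero, Real.sqrt_zero, mul_zero] at h0
  exact squeeze_zero (fun _ => dist_nonneg) (fun u => h u x) h0

theorem proposition1 (p : ℕ) (hp : 1 ≤ p) :
    (∀ q : Cube p → ℝ, (∀ x, 0 < q x) → LipschitzOnCube q →
      ∃ P : ProbabilityMeasure (Cube p),
        (∀ s : ℝ, 0 < s → ∀ D : (n : ℕ+) → (Fin n → Cube p),
          (∀ n, IsSmallestIndexMED s (fun x => 1 / q x) (D n)) →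
          Tendsto (fun n => empiricalMeasure (D n)) atTop (𝓝 P)) ∧
        HasNormalizedDensity P (fun x => 1 / q x ^ (2 * p))) ∧
    (∀ f : Cube p → ℝ, (∀ x, 0 < f x) →
      LipschitzOnCube (fun x => f x ^ (-(1 / (2 * (p : ℝ))))) →
      ∃ P : ProbabilityMeasure (Cube p),
        (∀ s : ℝ, 0 < s → ∀ D : (n : ℕ+) → (Fin n → Cube p),
          (∀ n, IsSmallestIndexMED s (fun x => f x ^ (1 / (2 * (p : ℝ)))) (D n)) →
          Tendsto (fun n => empiricalMeasure (D n)) atTop (𝓝 P)) ∧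
        HasNormalizedDensity P f) := by
  constructor
  · intro q hq0 hq
    obtain ⟨P, hP, hd⟩ := exists_tendsto_empiricalMeasure hp (w := fun x => 1 / q x)
      (continuous_const.div hq.continuous fun x => (hq0 x).ne') fun x => one_div_pos.mpr (hq0 x)
    refine ⟨P, fun s hs D hD => hP s hs D fun n => (hD n).1, ?_⟩
    simpa only [one_div_pow] using hd
  · intro f hf0 hf
    have hp' : (p : ℝ) ≠ 0 := by exact_mod_cast (by omega : p ≠ 0)
    -- Continuity is inherited from the reciprocal `f^(-1/(2p))`, the function assumed Lipschitz.
    have hw : Continuous fun x => f x ^ (1 / (2 * (p : ℝ))) := by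
      have h := hf.continuous.inv₀ fun x => (Real.rpow_pos_of_pos (hf0 x) _).ne'
      refine h.congr fun x => ?_
      rw [Pi.inv_apply, Real.rpow_neg (hf0 x).le, inv_inv]
    obtain ⟨P, hP, hd⟩ := exists_tendsto_empiricalMeasure hp hw
      fun x => Real.rpow_pos_of_pos (hf0 x) _
    refine ⟨P, fun s hs D hD => hP s hs D fun n => (hD n).1, ?_⟩
    have hpow : ∀ x, (f x ^ (1 / (2 * (p : ℝ)))) ^ (2 * p) = f x := fun x => by
      rw [← Real.rpow_natCast, ← Real.rpow_mul (hf0 x).le]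
      push_cast
      rw [one_div_mul_cancel (by positivity), Real.rpow_one]
    simpa only [hpow] using hd
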